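/- For $n\ge 1$ let $D_n\subset\mathbb{R}^n$ be the closed Euclidean unit ball centered at the origin and let $|\cdot|$ denote Lebesgue measure on $\mathbb{R}^n$. A polytope is a nonempty bounded intersection of finitely many closed half-spaces of $\mathbb{R}^n$; its facets are its faces of dimension one less than its own. Let $f(n)$ be a sequence with $f(n)=e^{\omega(n)}$, that is, $f(n)=e^{g(n)}$ for all large $n$, where $g(n)/n\to\infty$ as $n\to\infty$. Then $$\lim_{n\to\infty}\ \inf\left\{\frac{|D_n\,\Delta\,P|}{|D_n|}\ :\ P\subset\mathbb{R}^n\text{ is a polytope with at most } f(n)\text{ facets}\right\}=0 .$$ In particular, if for all large $n$ the polytope $P^b_{n,f(n)}\subset\mathbb{R}^n$ is best-approximating for $D_n$, i.e. minimizes $|D_n\,\Delta\,P|$ among the polytopes $P\subset\mathbb{R}^n$ with at most $f(n)$ facets, then $$\lim_{n\to\infty}\frac{|D_n\,\Delta\,P^b_{n,f(n)}|}{|D_n|}=0 .$$ -/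

import Mathlib

open Filter Topology MeasureTheory
open scoped ENNReal symmDiff

/-- The closed centered Euclidean unit ball `D_n` of `ℝⁿ`. -/
def unitBall (n : ℕ) : Set (EuclideanSpace ℝ (Fin n)) := Metric.closedBall 0 1

/-- A (convex) polytope in `ℝⁿ`: a nonempty bounded set that is the solution set of finitely
many linear inequalities, that is, a bounded intersection of finitely many closed half-spaces. -/
def IsPolytope {n : ℕ} (P : Set (EuclideanSpace ℝ (Fin n))) : Prop :=
  P.Nonempty ∧ Bornology.IsBounded P ∧
    ∃ (m : ℕ) (a : Fin m → EuclideanSpace ℝ (Fin n)) (b : Fin m → ℝ),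
      P = {x | ∀ i, inner ℝ (a i) x ≤ b i}

/-- The dimension of the affine hull of a nonempty set. -/
noncomputable def affineDim {n : ℕ} (F : Set (EuclideanSpace ℝ (Fin n))) : ℕ :=
  Module.finrank ℝ (vectorSpan ℝ F)

/-- The facets of a convex set `P`: its nonempty exposed faces of dimension `dim P - 1`
(for a polytope, every face is exposed). -/
def facets {n : ℕ} (P : Set (EuclideanSpace ℝ (Fin n))) :
    Set (Set (EuclideanSpace ℝ (Fin n))) :=
  {F | F.Nonempty ∧ IsExposed ℝ P F ∧ affineDim F + 1 = affineDim P}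

/-- The polytopes in `ℝⁿ` with at most `N` facets; `N` is a real number, so that a bound such
as `e ^ g` need not be an integer. -/
def polytopesWithFacetsLE (n : ℕ) (N : ℝ) : Set (Set (EuclideanSpace ℝ (Fin n))) :=
  {P | IsPolytope P ∧ (facets P).Finite ∧ ((facets P).ncard : ℝ) ≤ N}

/-- The symmetric volume difference `|A ∆ B|`. -/
noncomputable def symmVol {n : ℕ} (A B : Set (EuclideanSpace ℝ (Fin n))) : ℝ≥0∞ :=
  volume (A ∆ B)

/-- `P` is a best-approximating polytope of `D_n` among the polytopes with at most `N` facets,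
with respect to the symmetric volume difference. -/
def IsBestApprox (n : ℕ) (N : ℝ) (P : Set (EuclideanSpace ℝ (Fin n))) : Prop :=
  P ∈ polytopesWithFacetsLE n N ∧
    ∀ Q ∈ polytopesWithFacetsLE n N, symmVol (unitBall n) P ≤ symmVol (unitBall n) Q

/-!
The approximating polytopes are random. Let `v₁, …, v_N` be independent standard Gaussian vectors
of `ℝⁿ` and `P = {x | ⟪vᵢ, x⟫ ≤ t for all i} ∩ [-1, 1]ⁿ`. As `⟪vᵢ, x⟫` is normal with standard
deviation `‖x‖`, the expected number of inequalities violated at `x` is `N q(t / ‖x‖)`, where `q`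
is the standard normal tail. The number `N = ⌈q(t)⁻¹⌉` makes this about `1` on the unit sphere.
The function `s ↦ exp (s² / 2) q(s)` is decreasing (`exp_mul_gaussianTail_le`), so a change of `‖x‖`
from `1` to `1 ± ε / n` multiplies the expected number by roughly `exp (± t² ε / n)`. With
`t² = g(n) / 2` one has `t² / n → ∞` because `g(n) / n → ∞`: with probability tending to `1`, a
point with `‖x‖ ≤ 1 - ε / n` satisfies all inequalities and a point with `‖x‖ ≥ 1 + ε / n` violates
one, and the shell in between has a share of order `ε` of the volume. The double
exponential decay of the probability that an exterior point survives also beats the growth of the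
volume in the cube (`exp_neg_exp_le`): this probability is at most `ε ‖x‖⁻²ⁿ`, whose integral over
the exterior of the ball is `ε |D_n|`. By Tonelli's theorem the expected symmetric difference is at
most `6 ε |D_n|`, so some choice of the `vᵢ` does at least as well
(`exists_symmVol_slicedCube_le`).

The polytope `P` is given by `N + 2 n` inequalities that hold strictly at the origin, so it has at
most that many facets (`facets_subset_range`), and the crude bound
`q(t) ≥ (2 π)^(-1/2) exp (-(t + 1)² / 2)` yields `N + 2 n ≤ exp g(n)`. Only the normalisation
`N q(t) ≈ 1` has to be sharp, not the size of `q(t)`.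
-/

/-! ### Facets of a solution set of finitely many inequalities -/

/-- If no inequality is an equality on all of a convex subset `F` of the polyhedron, then some point
of `F` satisfies all inequalities strictly. -/
theorem exists_forall_inner_lt {n : ℕ} {ι : Type*} [Finite ι]
    (a : ι → EuclideanSpace ℝ (Fin n)) (b : ι → ℝ) {F : Set (EuclideanSpace ℝ (Fin n))}
    (hF : F.Nonempty) (hconv : Convex ℝ F) (hle : ∀ x ∈ F, ∀ i, inner ℝ (a i) x ≤ b i)
    (hlt : ∀ i, ∃ x ∈ F, inner ℝ (a i) x < b i) :
    ∃ x ∈ F, ∀ i, inner ℝ (a i) x < b i := by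
  classical
  cases nonempty_fintype ι
  suffices h : ∀ s : Finset ι, ∃ x ∈ F, ∀ i ∈ s, inner ℝ (a i) x < b i by
    obtain ⟨x, hx, h⟩ := h Finset.univ
    exact ⟨x, hx, fun i => h i (Finset.mem_univ i)⟩
  intro s
  induction s using Finset.induction_on with
  | empty => exact ⟨hF.some, hF.some_mem, by simp⟩
  | insert j s _ ih =>
    obtain ⟨x, hx, hxs⟩ := ih
    obtain ⟨y, hy, hyj⟩ := hlt j
    refine ⟨(1 / 2 : ℝ) • x + (1 / 2 : ℝ) • y,
      hconv hx hy (by norm_num) (by norm_num) (by norm_num), fun i hi => ?_⟩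
    rw [inner_add_right, real_inner_smul_right, real_inner_smul_right]
    have h1 := hle x hx i
    have h2 := hle y hy i
    rcases Finset.mem_insert.1 hi with rfl | hi
    · linarith
    · linarith [hxs i hi]

/-- A facet of a full-dimensional polyhedron lies on the boundary hyperplane of one of the
inequalities, and then is the whole intersection with that hyperplane, as both its supporting
hyperplane and the boundary hyperplane are its affine hull. -/
theorem facets_subset_range {n : ℕ} {ι : Type*} [Finite ι]
    (a : ι → EuclideanSpace ℝ (Fin n)) (b : ι → ℝ) (hb : ∀ i, 0 < b i) :
    facets {x | ∀ i, inner ℝ (a i) x ≤ b i} ⊆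
      Set.range fun j => {x | (∀ i, inner ℝ (a i) x ≤ b i) ∧ inner ℝ (a j) x = b j} := by
  set P : Set (EuclideanSpace ℝ (Fin n)) := {x | ∀ i, inner ℝ (a i) x ≤ b i} with hP
  have hPconv : Convex ℝ P := by
    intro x hx y hy s t hs ht hst i
    rw [inner_add_right, real_inner_smul_right, real_inner_smul_right]
    calc s * inner ℝ (a i) x + t * inner ℝ (a i) y ≤ s * b i + t * b i := by
          gcongr
          · exact hx i
          · exact hy i
      _ = b i := by rw [← add_mul, hst, one_mul]
  have hnhds : ∀ x, (∀ i, inner ℝ (a i) x < b i) → P ∈ 𝓝 x := by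
    intro x hx
    have : ∀ᶠ y in 𝓝 x, ∀ i, inner ℝ (a i) y < b i :=
      eventually_all.2 fun i =>
        (Continuous.tendsto (by fun_prop : Continuous fun y => inner ℝ (a i) y) x).eventually
          (gt_mem_nhds (hx i))
    filter_upwards [this] with y hy i using (hy i).le
  have hP0 : P ∈ 𝓝 0 := hnhds 0 fun i => by simpa using hb i
  have hdim : affineDim P = n := by
    have h := affineSpan_eq_top_of_nonempty_interior (s := P)
      (by rw [hPconv.convexHull_eq]; exact ⟨0, mem_interior_iff_mem_nhds.2 hP0⟩)
    have h' : vectorSpan ℝ P = ⊤ := by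
      rw [← direction_affineSpan, h, AffineSubspace.direction_top]
    rw [affineDim, h', finrank_top, finrank_euclideanSpace_fin]
  rintro F ⟨hFne, hFexp, hFdim⟩
  rw [hdim] at hFdim
  obtain ⟨l, hl⟩ := hFexp hFne
  have hFP : F ⊆ P := hFexp.subset
  have hl0 : l ≠ 0 := by
    rintro rfl
    have : F = P := by rw [hl]; ext x; simp
    rw [this, hdim] at hFdim
    omega
  have hexists : ∃ j, ∀ x ∈ F, inner ℝ (a j) x = b j := by
    by_contra! hcon
    obtain ⟨x, hxF, hx⟩ := exists_forall_inner_lt a b hFne (hFexp.convex hPconv)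
      (fun x hx => hFP hx) fun i => by
        obtain ⟨x, hx, hne⟩ := hcon i
        exact ⟨x, hx, lt_of_le_of_ne (hFP hx i) hne⟩
    have hmax : IsLocalMax l x := by
      rw [hl] at hxF
      filter_upwards [hnhds x hx] with y hy using hxF.2 y hy
    exact hl0 (by simpa using hmax.fderiv_eq_zero)
  obtain ⟨j, hj⟩ := hexists
  obtain ⟨x₀, hx₀⟩ := hFne
  have hker : ∀ k : Module.Dual ℝ (EuclideanSpace ℝ (Fin n)), k ≠ 0 →
      (∀ x ∈ F, k x = k x₀) → vectorSpan ℝ F = LinearMap.ker k := by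
    intro k hk hkF
    refine Submodule.eq_of_le_of_finrank_eq ?_ ?_
    · rw [vectorSpan_def, Submodule.span_le]
      rintro _ ⟨x, hx, y, hy, rfl⟩
      simp [hkF x hx, hkF y hy]
    · have h := Module.Dual.finrank_ker_add_one_of_ne_zero hk
      rw [finrank_euclideanSpace_fin] at h
      have : affineDim F = Module.finrank ℝ (vectorSpan ℝ F) := rfl
      omega
  have hl' : vectorSpan ℝ F = LinearMap.ker (l : _ →ₗ[ℝ] ℝ) := by
    refine hker _ (fun h => hl0 (by ext x; exact LinearMap.congr_fun h x)) fun x hx => ?_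
    rw [hl] at hx hx₀
    exact le_antisymm (hx₀.2 x hx.1) (hx.2 x₀ hx₀.1)
  have ha' : vectorSpan ℝ F = LinearMap.ker (innerSL ℝ (a j) : _ →ₗ[ℝ] ℝ) := by
    refine hker _ (fun h => ?_) fun x hx => by simp [hj x hx, hj x₀ hx₀]
    have h1 : inner ℝ (a j) x₀ = 0 := by simpa using LinearMap.congr_fun h x₀
    linarith [hj x₀ hx₀, hb j]
  refine ⟨j, Set.Subset.antisymm ?_ fun x hx => ⟨hFP hx, hj x hx⟩⟩
  rintro x ⟨hxP, hxj⟩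
  have hmem : x - x₀ ∈ LinearMap.ker (l : _ →ₗ[ℝ] ℝ) := by
    rw [← hl', ha']
    simp [inner_sub_right, hxj, hj x₀ hx₀]
  have hlx : l x = l x₀ := by simpa [sub_eq_zero] using hmem
  rw [hl] at hx₀ ⊢
  exact ⟨hxP, fun y hy => hlx ▸ hx₀.2 y hy⟩

theorem mem_polytopesWithFacetsLE {n : ℕ} {ι : Type*} [Fintype ι]
    (a : ι → EuclideanSpace ℝ (Fin n)) (b : ι → ℝ) (hb : ∀ i, 0 < b i)
    (hbdd : Bornology.IsBounded {x | ∀ i, inner ℝ (a i) x ≤ b i}) {M : ℝ}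
    (hM : (Fintype.card ι : ℝ) ≤ M) :
    {x | ∀ i, inner ℝ (a i) x ≤ b i} ∈ polytopesWithFacetsLE n M := by
  have hsub := facets_subset_range a b hb
  refine ⟨⟨⟨0, fun i => by simpa using (hb i).le⟩, hbdd, Fintype.card ι,
    a ∘ (Fintype.equivFin ι).symm, b ∘ (Fintype.equivFin ι).symm, ?_⟩,
    (Set.finite_range _).subset hsub, le_trans ?_ hM⟩
  · ext x
    exact ⟨fun h i => h _, fun h i => by simpa using h (Fintype.equivFin ι i)⟩
  · have h := Set.ncard_le_ncard hsub (Set.finite_range _)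
    rw [← Set.image_univ] at h
    have h2 := h.trans (Set.ncard_image_le Set.finite_univ)
    rw [Set.ncard_univ, Nat.card_eq_fintype_card] at h2
    exact_mod_cast h2

/-! ### Gaussian tails -/

/-- The tail `s ↦ ℙ(Z > s)` of a standard normal variable `Z`. -/
noncomputable def gaussianTail (s : ℝ) : ℝ :=
  (ProbabilityTheory.gaussianReal 0 1).real (Set.Ioi s)

theorem gaussianTail_nonneg (s : ℝ) : 0 ≤ gaussianTail s := measureReal_nonneg

theorem gaussianTail_le_one (s : ℝ) : gaussianTail s ≤ 1 := measureReal_le_one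

theorem gaussianTail_anti : Antitone gaussianTail := fun _ _ h =>
  measureReal_mono (Set.Ioi_subset_Ioi h)

theorem gaussianTail_eq_integral (s : ℝ) :
    gaussianTail s = ∫ y in Set.Ioi s, ProbabilityTheory.gaussianPDFReal 0 1 y := by
  rw [gaussianTail, measureReal_def,
    ProbabilityTheory.gaussianReal_apply_eq_integral 0 one_ne_zero, ENNReal.toReal_ofReal]
  exact integral_nonneg fun y => ProbabilityTheory.gaussianPDFReal_nonneg 0 1 y

theorem gaussianPDFReal_std (y : ℝ) : ProbabilityTheory.gaussianPDFReal 0 1 y =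
    (√(2 * Real.pi))⁻¹ * Real.exp (-y ^ 2 / 2) := by
  simp [ProbabilityTheory.gaussianPDFReal_def]

/-- The function `s ↦ exp (s² / 2) * gaussianTail s` is decreasing. -/
theorem exp_mul_gaussianTail_le {s t : ℝ} (hst : s ≤ t) :
    Real.exp ((t ^ 2 - s ^ 2) / 2) * gaussianTail t ≤ gaussianTail s := by
  have hint := ProbabilityTheory.integrable_gaussianPDFReal 0 1
  have key : ∫ y in Set.Ioi t, ProbabilityTheory.gaussianPDFReal 0 1 (y - (t - s)) =
      ∫ y in Set.Ioi s, ProbabilityTheory.gaussianPDFReal 0 1 y := by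
    have h := (measurePreserving_sub_right volume (t - s)).setIntegral_preimage_emb
      (MeasurableEquiv.subRight (t - s)).measurableEmbedding
      (ProbabilityTheory.gaussianPDFReal 0 1) (Set.Ioi s)
    simpa using h
  rw [gaussianTail_eq_integral, gaussianTail_eq_integral, ← key, ← integral_const_mul]
  refine setIntegral_mono_on (hint.integrableOn.const_mul _)
    (hint.comp_sub_right (t - s)).integrableOn measurableSet_Ioi fun y hy => ?_
  rw [gaussianPDFReal_std, gaussianPDFReal_std, mul_left_comm, ← Real.exp_add]
  gcongr
  have hy' : t < y := hy
  nlinarith [mul_nonneg (sub_nonneg.2 hst) (sub_nonneg.2 hy'.le)]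

theorem exp_le_gaussianTail {t : ℝ} (ht : 0 ≤ t) :
    (√(2 * Real.pi))⁻¹ * Real.exp (-(t + 1) ^ 2 / 2) ≤ gaussianTail t := by
  have hint := ProbabilityTheory.integrable_gaussianPDFReal 0 1
  rw [gaussianTail_eq_integral]
  calc (√(2 * Real.pi))⁻¹ * Real.exp (-(t + 1) ^ 2 / 2)
      = ∫ _ in Set.Ioc t (t + 1), (√(2 * Real.pi))⁻¹ * Real.exp (-(t + 1) ^ 2 / 2) := by simp
    _ ≤ ∫ y in Set.Ioc t (t + 1), ProbabilityTheory.gaussianPDFReal 0 1 y := by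
        refine setIntegral_mono_on (integrableOn_const (by simp)) hint.integrableOn
          measurableSet_Ioc fun y hy => ?_
        rw [gaussianPDFReal_std]
        gcongr
        · linarith [hy.1]
        · exact hy.2
    _ ≤ _ := setIntegral_mono_set hint.integrableOn
        (ae_of_all _ fun y => ProbabilityTheory.gaussianPDFReal_nonneg 0 1 y)
        (LE.le.eventuallyLE Set.Ioc_subset_Ioi_self)

theorem gaussianTail_pos {t : ℝ} (ht : 0 ≤ t) : 0 < gaussianTail t :=
  lt_of_lt_of_le (by positivity) (exp_le_gaussianTail ht)

/-- For a standard Gaussian vector `v`, the variable `⟪v, x⟫` is normal with standard deviation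
`‖x‖`. -/
theorem stdGaussian_real_lt_inner {n : ℕ} {x : EuclideanSpace ℝ (Fin n)} (hx : x ≠ 0) (t : ℝ) :
    (ProbabilityTheory.stdGaussian (EuclideanSpace ℝ (Fin n))).real {v | t < inner ℝ v x} =
      gaussianTail (t / ‖x‖) := by
  have hx' : 0 < ‖x‖ := norm_pos_iff.2 hx
  have hmap : (ProbabilityTheory.stdGaussian (EuclideanSpace ℝ (Fin n))).map (innerSL ℝ x) =
      (ProbabilityTheory.gaussianReal 0 1).map (‖x‖ * ·) := by
    rw [ProbabilityTheory.IsGaussian.map_eq_gaussianReal,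
      ProbabilityTheory.integral_strongDual_stdGaussian,
      ProbabilityTheory.variance_dual_stdGaussian, ProbabilityTheory.gaussianReal_map_const_mul]
    congr 1
    · simp
    · ext; simp
  have h1 : {v : EuclideanSpace ℝ (Fin n) | t < inner ℝ v x} = innerSL ℝ x ⁻¹' Set.Ioi t := by
    ext v; simp [real_inner_comm]
  rw [h1, gaussianTail, measureReal_def, measureReal_def,
    ← Measure.map_apply (by fun_prop) measurableSet_Ioi, hmap,
    Measure.map_apply (by fun_prop) measurableSet_Ioi]
  congr 2
  ext y
  simp [div_lt_iff₀' hx']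

/-! ### Random polytopes with Gaussian normals -/

/-- The polytope cut out of the cube `[-1, 1]ⁿ` by the inequalities `⟪v i, x⟫ ≤ t`. The cube only
serves to make the polytope bounded. -/
def slicedCube {n N : ℕ} (t : ℝ) (v : Fin N → EuclideanSpace ℝ (Fin n)) :
    Set (EuclideanSpace ℝ (Fin n)) :=
  {x | (∀ i, inner ℝ (v i) x ≤ t) ∧ ∀ j, |x j| ≤ 1}

theorem norm_sq_le_of_mem_slicedCube {n N : ℕ} {t : ℝ} {v : Fin N → EuclideanSpace ℝ (Fin n)}
    {x : EuclideanSpace ℝ (Fin n)} (hx : x ∈ slicedCube t v) : ‖x‖ ^ 2 ≤ n := by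
  rw [EuclideanSpace.norm_sq_eq]
  calc ∑ j, ‖x j‖ ^ 2 ≤ ∑ _j : Fin n, (1 : ℝ) := Finset.sum_le_sum fun j _ => by
        rw [Real.norm_eq_abs]; exact pow_le_one₀ (abs_nonneg _) (hx.2 j)
    _ = n := by simp

theorem slicedCube_mem_polytopesWithFacetsLE {n N : ℕ} {t : ℝ} (ht : 0 < t)
    (v : Fin N → EuclideanSpace ℝ (Fin n)) {M : ℝ} (hM : (N + 2 * n : ℝ) ≤ M) :
    slicedCube t v ∈ polytopesWithFacetsLE n M := by
  have heq : slicedCube t v = {x | ∀ i : Fin N ⊕ Fin n ⊕ Fin n,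
      inner ℝ (Sum.elim v (Sum.elim (fun j => EuclideanSpace.single j (1 : ℝ))
        fun j => -EuclideanSpace.single j (1 : ℝ)) i) x ≤
        Sum.elim (fun _ => t) (Sum.elim (fun _ => 1) fun _ => 1) i} := by
    ext x
    simp only [slicedCube, Set.mem_ofPred_eq, Sum.forall, Sum.elim_inl, Sum.elim_inr,
      inner_neg_left, EuclideanSpace.inner_single_left, map_one, one_mul, abs_le',
      forall_and]
  rw [heq]
  refine mem_polytopesWithFacetsLE _ _ (by simp [ht]) ?_ ?_
  · rw [← heq]
    refine (Metric.isBounded_closedBall (x := 0) (r := √n)).subset fun x hx => ?_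
    rw [mem_closedBall_zero_iff]
    exact Real.le_sqrt_of_sq_le (norm_sq_le_of_mem_slicedCube hx)
  · refine le_trans (le_of_eq ?_) hM
    simp [two_mul]

theorem isClosed_slicedCube_prod {n N : ℕ} (t : ℝ) :
    IsClosed {p : EuclideanSpace ℝ (Fin n) × (Fin N → EuclideanSpace ℝ (Fin n)) |
      p.1 ∈ slicedCube t p.2} := by
  have h1 : IsClosed {p : EuclideanSpace ℝ (Fin n) × (Fin N → EuclideanSpace ℝ (Fin n)) |
      ∀ i, inner ℝ (p.2 i) p.1 ≤ t} := by
    rw [Set.ofPred_forall]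
    exact isClosed_iInter fun i => isClosed_le (by fun_prop) (by fun_prop)
  have h2 : IsClosed {p : EuclideanSpace ℝ (Fin n) × (Fin N → EuclideanSpace ℝ (Fin n)) |
      ∀ j, |p.1 j| ≤ 1} := by
    rw [Set.ofPred_forall]
    exact isClosed_iInter fun j => isClosed_le (by fun_prop) (by fun_prop)
  exact h1.inter h2

/-- The law of `N` independent standard Gaussian vectors of `ℝⁿ`. -/
noncomputable def gaussianTuple (n N : ℕ) : Measure (Fin N → EuclideanSpace ℝ (Fin n)) :=
  Measure.pi fun _ => ProbabilityTheory.stdGaussian (EuclideanSpace ℝ (Fin n))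

instance (n N : ℕ) : IsProbabilityMeasure (gaussianTuple n N) := by
  unfold gaussianTuple; infer_instance

theorem gaussianTuple_real_forall_inner_le {n N : ℕ} {x : EuclideanSpace ℝ (Fin n)} (hx : x ≠ 0)
    (t : ℝ) : (gaussianTuple n N).real {v | ∀ i, inner ℝ (v i) x ≤ t} =
      (1 - gaussianTail (t / ‖x‖)) ^ N := by
  have h1 : {v : Fin N → EuclideanSpace ℝ (Fin n) | ∀ i, inner ℝ (v i) x ≤ t} =
      Set.univ.pi fun _ => {w | t < inner ℝ w x}ᶜ := by
    ext v; simp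
  have hmeas : MeasurableSet {w : EuclideanSpace ℝ (Fin n) | t < inner ℝ w x} :=
    (isOpen_lt (by fun_prop) (by fun_prop)).measurableSet
  rw [h1, gaussianTuple, measureReal_def, Measure.pi_pi, Finset.prod_const, Finset.card_univ,
    Fintype.card_fin, ENNReal.toReal_pow, ← measureReal_def, probReal_compl_eq_one_sub hmeas,
    stdGaussian_real_lt_inner hx]

theorem gaussianTuple_real_forall_inner_le_le {n N : ℕ} {x : EuclideanSpace ℝ (Fin n)}
    (hx : x ≠ 0) (t : ℝ) : (gaussianTuple n N).real {v | ∀ i, inner ℝ (v i) x ≤ t} ≤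
      Real.exp (-(N * gaussianTail (t / ‖x‖))) := by
  rw [gaussianTuple_real_forall_inner_le hx, ← mul_neg, Real.exp_nat_mul]
  refine pow_le_pow_left₀ (by linarith [gaussianTail_le_one (t / ‖x‖)]) ?_ N
  linarith [Real.add_one_le_exp (-gaussianTail (t / ‖x‖))]

theorem gaussianTuple_real_exists_lt_inner_le {n N : ℕ} {x : EuclideanSpace ℝ (Fin n)}
    (hx : x ≠ 0) (t : ℝ) : (gaussianTuple n N).real {v | ∃ i, t < inner ℝ (v i) x} ≤
      N * gaussianTail (t / ‖x‖) := by
  have hmeas : MeasurableSet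
      {v : Fin N → EuclideanSpace ℝ (Fin n) | ∀ i, inner ℝ (v i) x ≤ t} := by
    simp only [Set.ofPred_forall]
    exact (isClosed_iInter fun i => isClosed_le (by fun_prop) (by fun_prop)).measurableSet
  have h1 : {v : Fin N → EuclideanSpace ℝ (Fin n) | ∃ i, t < inner ℝ (v i) x} =
      {v | ∀ i, inner ℝ (v i) x ≤ t}ᶜ := by
    ext v; simp
  rw [h1, probReal_compl_eq_one_sub hmeas, gaussianTuple_real_forall_inner_le hx]
  have h := one_add_mul_le_pow (a := -gaussianTail (t / ‖x‖))
    (by linarith [gaussianTail_le_one (t / ‖x‖)]) N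
  rw [← sub_eq_add_neg] at h
  linarith

/-! ### Estimates for the probability of misclassifying a point -/

/-- With `w = 1 - r⁻²`, the claim is `2 n log r + log ε⁻¹ ≤ exp (n H w / 2)`; for `w ≤ 1 / 2` it
follows from `log r ≤ w`, and for larger `w` the crude bound `2 log r ≤ r² ≤ n` suffices. -/
theorem exp_neg_exp_le {n : ℕ} (hn : 1 ≤ n) {ε H r : ℝ} (hε : 0 < ε) (hε1 : ε ≤ 1) (hH : 8 ≤ H)
    (hHε : 4 * Real.log ε⁻¹ ≤ H * ε) (hr : 1 + ε / n ≤ r) (hrn : r ^ 2 ≤ n) :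
    Real.exp (-Real.exp (n * H * (1 - (r ^ 2)⁻¹) / 2)) ≤ ε * (r ^ (2 * n))⁻¹ := by
  have hn' : (1 : ℝ) ≤ n := by exact_mod_cast hn
  have hn0 : (0 : ℝ) < n := by linarith
  have hεn : 0 < ε / n := by positivity
  have hr1 : 1 < r := by linarith
  have hr0 : 0 < r := by linarith
  set w := 1 - (r ^ 2)⁻¹ with hw
  set L := Real.log ε⁻¹ with hL
  have hL0 : 0 ≤ L := Real.log_nonneg (one_le_inv₀ hε |>.2 hε1)
  have hlog : 0 < Real.log r := Real.log_pos hr1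
  have hlogr : Real.log (r ^ 2) = 2 * Real.log r := by rw [Real.log_pow]; norm_num
  have hr2 : 1 < r ^ 2 := by nlinarith
  have hw0 : 0 < w := by rw [hw]; linarith [inv_lt_one_of_one_lt₀ hr2]
  suffices h : 2 * n * Real.log r + L ≤ Real.exp (n * H * w / 2) by
    rw [← Real.exp_log (show 0 < ε * (r ^ (2 * n))⁻¹ by positivity),
      Real.log_mul hε.ne' (by positivity), Real.log_inv, Real.log_pow]
    have : L = -Real.log ε := Real.log_inv ε
    push_cast
    gcongr
    linarith
  rcases le_total w (1 / 2) with hw2 | hw2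
  · -- `log r² ≤ r² - 1 = r² w` and `r² ≤ 2`
    have h1 : Real.log r ≤ w := by
      have h2 := Real.log_le_sub_one_of_pos (show 0 < r ^ 2 by positivity)
      have h3 : r ^ 2 * w = r ^ 2 - 1 := by rw [hw]; field_simp
      have h4 : r ^ 2 ≤ 2 := by nlinarith
      nlinarith
    -- `w ≥ 1 - (1 + ε / n)⁻² ≥ ε / (2 n)`, as `ε / n ≤ 1`
    have h5 : ε ≤ 2 * n * w := by
      have h6 : r ^ 2 * w = r ^ 2 - 1 := by rw [hw]; field_simp
      have h7 : ε / n ≤ 1 := by rw [div_le_one hn0]; linarith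
      have h8 : (1 + ε / n) ^ 2 ≤ r ^ 2 := by gcongr
      have h9 : ε / n ≤ 2 * w := by
        nlinarith
      rw [div_le_iff₀ hn0] at h9
      linarith
    set y := n * H * w / 2 with hy
    have h6 : L ≤ y := by rw [hy]; nlinarith
    have h7 : 2 * n * Real.log r ≤ y := by
      have : 2 * n * Real.log r ≤ 2 * n * w := by gcongr
      rw [hy]
      nlinarith [mul_pos hn0 hw0]
    have hy0 : 0 ≤ y := by rw [hy]; positivity
    nlinarith [Real.quadratic_le_exp_of_nonneg hy0, sq_nonneg (y - 1)]
  · have h1 : 2 * Real.log r ≤ n := by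
      rw [← hlogr]
      linarith [Real.log_le_sub_one_of_pos (show 0 < r ^ 2 by positivity)]
    set z := n * H / 4 with hz
    have hz0 : 0 ≤ z := by rw [hz]; positivity
    have h2 : z ≤ n * H * w / 2 := by
      rw [hz]; nlinarith [mul_pos hn0 (show 0 < H by linarith)]
    have h3 : 2 * n * Real.log r ≤ z ^ 2 / 2 := by
      have h4 : 2 * (n : ℝ) ≤ z := by rw [hz]; nlinarith
      nlinarith
    have h5 : L ≤ z := by
      have : H ≤ n * H := by nlinarith
      rw [hz]; nlinarith
    have := Real.quadratic_le_exp_of_nonneg hz0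
    have := Real.exp_le_exp.2 h2
    linarith

/-- A point well inside the ball is rarely cut off. -/
theorem gaussianTuple_real_mem_symmDiff_le_of_norm_le {n N : ℕ} (hn : 1 ≤ n) {ε H t : ℝ}
    (hε : 0 < ε) (ht : 0 < t) (hHt : t ^ 2 = n * H) (hHε : Real.log ε⁻¹ ≤ H * ε)
    (hN : N * gaussianTail t ≤ 2) {x : EuclideanSpace ℝ (Fin n)} (hx : ‖x‖ ≤ 1 - ε / n) :
    (gaussianTuple n N).real {v | x ∈ unitBall n ∆ slicedCube t v} ≤ 2 * ε := by
  have hn0 : (0 : ℝ) < n := by exact_mod_cast hn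
  have hεn : 0 < ε / n := by positivity
  have hxball : x ∈ unitBall n := mem_closedBall_zero_iff.2 (by linarith)
  have hcube : ∀ j, |x j| ≤ 1 := fun j =>
    (PiLp.norm_apply_le x j).trans (by linarith)
  have hsub : {v : Fin N → EuclideanSpace ℝ (Fin n) | x ∈ unitBall n ∆ slicedCube t v} ⊆
      {v | ∃ i, t < inner ℝ (v i) x} := by
    intro v hv
    rcases hv with hv | hv
    · by_contra hcon
      simp only [Set.mem_ofPred_eq, not_exists, not_lt] at hcon
      exact hv.2 ⟨hcon, hcube⟩
    · exact absurd hxball hv.2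
  refine (measureReal_mono hsub).trans ?_
  rcases eq_or_ne x 0 with rfl | hx0
  · simp [not_lt.2 ht.le, hε.le]
  refine (gaussianTuple_real_exists_lt_inner_le hx0 t).trans ?_
  have hx0' : 0 < ‖x‖ := norm_pos_iff.2 hx0
  set s := 1 - ε / n with hs
  have hs0 : 0 < s := by linarith
  have hs1 : s < 1 := by linarith
  have h1 : gaussianTail (t / ‖x‖) ≤ gaussianTail (t / s) :=
    gaussianTail_anti (by gcongr)
  have h2 := exp_mul_gaussianTail_le (show t ≤ t / s by
    rw [le_div_iff₀ hs0]; nlinarith)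
  -- `s⁻² - 1 ≥ 2 (1 - s) = 2 ε / n`
  have h3 : H * ε ≤ ((t / s) ^ 2 - t ^ 2) / 2 := by
    have h4 : 1 + 2 * (ε / n) ≤ (s ^ 2)⁻¹ := by
      rw [le_inv_comm₀ (by positivity) (by positivity), inv_eq_one_div,
        le_div_iff₀ (by positivity)]
      have : ε / n = 1 - s := by rw [hs]; ring
      rw [this]
      nlinarith [mul_nonneg (sq_nonneg (1 - s)) (show 0 ≤ 1 + 2 * s by linarith)]
    have h5 : t ^ 2 * (1 + 2 * (ε / n)) ≤ t ^ 2 * (s ^ 2)⁻¹ := by gcongr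
    have h6 : t ^ 2 * (ε / n) = H * ε := by rw [hHt]; field_simp
    rw [div_pow, div_eq_mul_inv (t ^ 2)]
    linarith
  have h4 : ε⁻¹ ≤ Real.exp (((t / s) ^ 2 - t ^ 2) / 2) := by
    rw [← Real.exp_log (inv_pos.2 hε)]
    exact Real.exp_le_exp.2 (hHε.trans h3)
  have h5 : ε⁻¹ * gaussianTail (t / s) ≤ gaussianTail t :=
    (mul_le_mul_of_nonneg_right h4 (gaussianTail_nonneg _)).trans h2
  rw [inv_mul_le_iff₀ hε] at h5
  calc N * gaussianTail (t / ‖x‖) ≤ N * (ε * gaussianTail t) := by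
        gcongr
        exact h1.trans h5
    _ = ε * (N * gaussianTail t) := by ring
    _ ≤ ε * 2 := by gcongr
    _ = 2 * ε := by ring

/-- A point well outside the ball is likely cut off, with a bound that is integrable over the
exterior of the ball. -/
theorem gaussianTuple_real_mem_symmDiff_le_of_le_norm {n N : ℕ} (hn : 1 ≤ n) {ε H t : ℝ}
    (hε : 0 < ε) (hε1 : ε ≤ 1) (ht : 0 < t) (hHt : t ^ 2 = n * H) (hH : 8 ≤ H)
    (hHε : 4 * Real.log ε⁻¹ ≤ H * ε) (hN : 1 ≤ N * gaussianTail t)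
    {x : EuclideanSpace ℝ (Fin n)} (hx : 1 + ε / n ≤ ‖x‖) :
    (gaussianTuple n N).real {v | x ∈ unitBall n ∆ slicedCube t v} ≤
      ε * (‖x‖ ^ (2 * n))⁻¹ := by
  have hn0 : (0 : ℝ) < n := by exact_mod_cast hn
  have hεn : 0 < ε / n := by positivity
  have hx1 : 1 < ‖x‖ := by linarith
  have hx0 : x ≠ 0 := norm_pos_iff.1 (by linarith)
  have hxball : x ∉ unitBall n := fun h => by
    linarith [mem_closedBall_zero_iff.1 h]
  have hmem : ∀ v : Fin N → EuclideanSpace ℝ (Fin n), x ∈ unitBall n ∆ slicedCube t v →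
      x ∈ slicedCube t v := by
    intro v hv
    rcases hv with hv | hv
    · exact absurd hv.1 hxball
    · exact hv.1
  by_cases hxn : ‖x‖ ^ 2 ≤ n
  · refine le_trans ?_ (exp_neg_exp_le hn hε hε1 hH hHε hx hxn)
    refine (measureReal_mono fun v hv => (hmem v hv).1).trans
      ((gaussianTuple_real_forall_inner_le_le hx0 t).trans ?_)
    have h2 := exp_mul_gaussianTail_le (show t / ‖x‖ ≤ t from div_le_self ht.le hx1.le)
    have h3 : (t ^ 2 - (t / ‖x‖) ^ 2) / 2 = n * H * (1 - (‖x‖ ^ 2)⁻¹) / 2 := by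
      rw [← hHt, div_pow, div_eq_mul_inv (t ^ 2)]; ring
    rw [h3] at h2
    gcongr
    calc Real.exp (n * H * (1 - (‖x‖ ^ 2)⁻¹) / 2)
        ≤ Real.exp (n * H * (1 - (‖x‖ ^ 2)⁻¹) / 2) * (N * gaussianTail t) :=
          le_mul_of_one_le_right (Real.exp_nonneg _) hN
      _ = N * (Real.exp (n * H * (1 - (‖x‖ ^ 2)⁻¹) / 2) * gaussianTail t) := by ring
      _ ≤ N * gaussianTail (t / ‖x‖) := by gcongr
  · have : {v : Fin N → EuclideanSpace ℝ (Fin n) | x ∈ unitBall n ∆ slicedCube t v} = ∅ := by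
      ext v
      simp only [Set.mem_ofPred_eq, Set.mem_empty_iff_false, iff_false]
      exact fun hv => hxn (norm_sq_le_of_mem_slicedCube (hmem v hv))
    rw [this, measureReal_empty]
    positivity

/-! ### The expected volume of the symmetric difference -/

theorem volume_unitBall_ne_zero (n : ℕ) : volume (unitBall n) ≠ 0 :=
  (Metric.measure_closedBall_pos volume 0 one_pos).ne'

theorem volume_unitBall_ne_top (n : ℕ) : volume (unitBall n) ≠ ⊤ :=
  measure_closedBall_lt_top.ne

theorem lintegral_compl_unitBall_norm_pow {n : ℕ} (hn : 1 ≤ n) :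
    ∫⁻ x in (unitBall n)ᶜ, ENNReal.ofReal (‖x‖ ^ (2 * n))⁻¹ = volume (unitBall n) := by
  have hn0 : (0 : ℝ) < n := by exact_mod_cast hn
  have : Nonempty (Fin n) := ⟨⟨0, hn⟩⟩
  set f : ℝ → ℝ := (Set.Ioi 1).indicator fun y => (y ^ (2 * n))⁻¹ with hf
  have hmeas : MeasurableSet (unitBall n) := Metric.isClosed_closedBall.measurableSet
  have h1 : ∀ x : EuclideanSpace ℝ (Fin n), (unitBall n)ᶜ.indicator
      (fun x => ENNReal.ofReal (‖x‖ ^ (2 * n))⁻¹) x = ENNReal.ofReal (f ‖x‖) := by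
    intro x
    by_cases hx : 1 < ‖x‖
    · have : x ∈ (unitBall n)ᶜ := by simpa [unitBall] using hx
      simp [hf, this, hx]
    · have : x ∉ (unitBall n)ᶜ := by simpa [unitBall] using hx
      simp [hf, this, hx]
  have hrad : ∀ y ∈ Set.Ioi (1 : ℝ), y ^ (n - 1) • (y ^ (2 * n))⁻¹ = y ^ (-(n : ℝ) - 1) := by
    intro y hy
    have hy0 : 0 < y := lt_trans one_pos hy
    rw [smul_eq_mul, ← Real.rpow_natCast, ← Real.rpow_natCast, ← Real.rpow_neg hy0.le,
      ← Real.rpow_add hy0]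
    congr 1
    push_cast [Nat.cast_sub hn]
    ring
  have hind : (fun y : ℝ => y ^ (n - 1) • f y) =
      (Set.Ioi 1).indicator fun y => y ^ (n - 1) • (y ^ (2 * n))⁻¹ := by
    ext y
    by_cases hy : 1 < y <;> simp [hf, hy]
  have hsub : Set.Ioi (0 : ℝ) ∩ Set.Ioi 1 = Set.Ioi 1 :=
    Set.inter_eq_right.2 (Set.Ioi_subset_Ioi zero_le_one)
  have hint : Integrable fun x : EuclideanSpace ℝ (Fin n) => f ‖x‖ := by
    rw [integrable_fun_norm_addHaar, finrank_euclideanSpace_fin, hind, IntegrableOn,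
      integrable_indicator_iff measurableSet_Ioi, IntegrableOn,
      Measure.restrict_restrict measurableSet_Ioi, Set.inter_comm, hsub]
    exact (integrableOn_congr_fun hrad measurableSet_Ioi).2
      (integrableOn_Ioi_rpow_of_lt (by linarith) one_pos)
  rw [← lintegral_indicator hmeas.compl, lintegral_congr h1,
    ← ofReal_integral_eq_lintegral_ofReal hint (ae_of_all _ fun x =>
      Set.indicator_apply_nonneg fun hx => inv_nonneg.2 (pow_nonneg (norm_nonneg x) _)),
    integral_fun_norm_addHaar, finrank_euclideanSpace_fin, hind,
    setIntegral_indicator measurableSet_Ioi, hsub, setIntegral_congr_fun measurableSet_Ioi hrad,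
    integral_Ioi_rpow_of_lt (by linarith) one_pos]
  have h2 : n • volume.real (Metric.ball (0 : EuclideanSpace ℝ (Fin n)) 1) •
      (-(1 : ℝ) ^ (-(n : ℝ) - 1 + 1) / (-(n : ℝ) - 1 + 1)) =
      volume.real (Metric.ball (0 : EuclideanSpace ℝ (Fin n)) 1) := by
    rw [Real.one_rpow, sub_add_cancel, nsmul_eq_mul, smul_eq_mul]
    field_simp
  rw [h2, unitBall, Measure.addHaar_closedBall_eq_addHaar_ball, ofReal_measureReal]

/-- The shell of half-width `ε / n` around the unit sphere has a small share of the volume. -/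
theorem volume_shell_le {n : ℕ} (hn : 1 ≤ n) {ε : ℝ} (hε : 0 < ε) (hε1 : ε ≤ 1) :
    volume (Metric.closedBall (0 : EuclideanSpace ℝ (Fin n)) (1 + ε / n) \
      Metric.closedBall 0 (1 - ε / n)) ≤ ENNReal.ofReal (3 * ε) * volume (unitBall n) := by
  have hn' : (1 : ℝ) ≤ n := by exact_mod_cast hn
  have hn0 : (0 : ℝ) < n := by linarith
  have hεn : 0 < ε / n := by positivity
  have hεn1 : ε / n ≤ 1 := by rw [div_le_one hn0]; linarith
  have hmul : n * (ε / n) = ε := by field_simp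
  rw [measure_sdiff (Metric.closedBall_subset_closedBall (by linarith))
    Metric.isClosed_closedBall.nullMeasurableSet measure_closedBall_lt_top.ne,
    Measure.addHaar_closedBall' _ _ (show 0 ≤ 1 + ε / n by linarith),
    Measure.addHaar_closedBall' _ _ (show 0 ≤ 1 - ε / n by linarith),
    finrank_euclideanSpace_fin, tsub_le_iff_right, unitBall, ← add_mul,
    ← ENNReal.ofReal_add (by positivity) (pow_nonneg (by linarith) _)]
  gcongr
  have h1 : (1 + ε / n) ^ n ≤ Real.exp ε := by
    calc (1 + ε / n) ^ n ≤ Real.exp (ε / n) ^ n := by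
          gcongr
          linarith [Real.add_one_le_exp (ε / n)]
      _ = Real.exp ε := by rw [← Real.exp_nat_mul, hmul]
  have h2 : Real.exp ε ≤ 1 + 2 * ε := by
    have := Real.abs_exp_sub_one_le (x := ε) (by rwa [abs_of_pos hε])
    rw [abs_of_pos hε] at this
    linarith [le_abs_self (Real.exp ε - 1)]
  have h3 : 1 - ε ≤ (1 - ε / n) ^ n := by
    have := one_add_mul_le_pow (a := -(ε / n)) (by linarith) n
    rw [mul_neg, hmul, ← sub_eq_add_neg, ← sub_eq_add_neg] at this
    exact this
  linarith

/-- The expected volume of the symmetric difference is the integral over `x` of the probability that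
`x` lies in it, and some tuple of normals does not exceed the expectation. -/
theorem exists_symmVol_slicedCube_le {n N : ℕ} (hn : 1 ≤ n) {ε H t : ℝ}
    (hε : 0 < ε) (hε1 : ε ≤ 1) (ht : 0 < t) (hHt : t ^ 2 = n * H) (hH : 8 ≤ H)
    (hHε : 4 * Real.log ε⁻¹ ≤ H * ε) (hN1 : 1 ≤ N * gaussianTail t)
    (hN2 : N * gaussianTail t ≤ 2) :
    ∃ v : Fin N → EuclideanSpace ℝ (Fin n),
      symmVol (unitBall n) (slicedCube t v) ≤ ENNReal.ofReal (6 * ε) * volume (unitBall n) := by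
  set S : Set (EuclideanSpace ℝ (Fin n) × (Fin N → EuclideanSpace ℝ (Fin n))) :=
    {p | p.1 ∈ unitBall n ∆ slicedCube t p.2} with hS
  have hball : MeasurableSet (unitBall n) := Metric.isClosed_closedBall.measurableSet
  have hSmeas : MeasurableSet S :=
    (measurable_fst hball).symmDiff (isClosed_slicedCube_prod t).measurableSet
  obtain ⟨v, hv⟩ := exists_le_lintegral (μ := gaussianTuple n N)
    (measurable_measure_prodMk_right (μ := volume) hSmeas).aemeasurable
  refine ⟨v, hv.trans ?_⟩
  rw [← Measure.prod_apply_symm hSmeas, Measure.prod_apply hSmeas]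
  set A := Metric.closedBall (0 : EuclideanSpace ℝ (Fin n)) (1 + ε / n) \
      Metric.closedBall 0 (1 - ε / n) with hA
  have hAmeas : MeasurableSet A :=
    Metric.isClosed_closedBall.measurableSet.diff Metric.isClosed_closedBall.measurableSet
  have hεn : 0 < ε / n := by
    have : (0 : ℝ) < n := by exact_mod_cast hn
    positivity
  have hbound : ∀ x, gaussianTuple n N (Prod.mk x ⁻¹' S) ≤
      (unitBall n).indicator (fun _ => ENNReal.ofReal (2 * ε)) x + A.indicator 1 x +
        (unitBall n)ᶜ.indicator
          (fun x => ENNReal.ofReal ε * ENNReal.ofReal (‖x‖ ^ (2 * n))⁻¹) x := by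
    intro x
    rcases le_or_gt ‖x‖ (1 - ε / n) with hx | hx
    · have hxb : x ∈ unitBall n := mem_closedBall_zero_iff.2 (by linarith)
      refine le_trans ?_ (le_add_right (le_add_right le_rfl))
      rw [Set.indicator_of_mem hxb]
      refine ENNReal.le_ofReal_iff_toReal_le (measure_ne_top _ _) (by positivity) |>.2 ?_
      have hL : Real.log ε⁻¹ ≤ H * ε := by
        linarith [Real.log_nonneg ((one_le_inv₀ hε).2 hε1)]
      exact gaussianTuple_real_mem_symmDiff_le_of_norm_le hn hε ht hHt hL hN2 hx
    rcases le_or_gt ‖x‖ (1 + ε / n) with hx' | hx'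
    · have hxA : x ∈ A := ⟨mem_closedBall_zero_iff.2 hx', fun h => by
        linarith [mem_closedBall_zero_iff.1 h]⟩
      refine le_trans prob_le_one ?_
      rw [Set.indicator_of_mem hxA, Pi.one_apply]
      exact le_add_right (le_add_left le_rfl)
    · have hxb : x ∈ (unitBall n)ᶜ := fun h => by
        linarith [mem_closedBall_zero_iff.1 h]
      refine le_trans ?_ (le_add_left le_rfl)
      rw [Set.indicator_of_mem hxb, ← ENNReal.ofReal_mul hε.le]
      refine ENNReal.le_ofReal_iff_toReal_le (measure_ne_top _ _) (by positivity) |>.2 ?_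
      exact gaussianTuple_real_mem_symmDiff_le_of_le_norm hn hε hε1 ht hHt hH hHε hN1 hx'.le
  refine (lintegral_mono hbound).trans ?_
  rw [lintegral_add_left (by measurability), lintegral_add_left (by measurability),
    lintegral_indicator_const hball, lintegral_indicator_one hAmeas,
    lintegral_indicator hball.compl, lintegral_const_mul' _ _ ENNReal.ofReal_ne_top,
    lintegral_compl_unitBall_norm_pow hn]
  calc _ ≤ ENNReal.ofReal (2 * ε) * volume (unitBall n) +
        ENNReal.ofReal (3 * ε) * volume (unitBall n) +
        ENNReal.ofReal ε * volume (unitBall n) := by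
        gcongr
        exact volume_shell_le hn hε hε1
    _ = _ := by
        rw [← add_mul, ← add_mul, ← ENNReal.ofReal_add (by positivity) (by positivity),
          ← ENNReal.ofReal_add (by positivity) (by positivity)]
        congr 2
        ring

/-! ### The number of facets and the limit -/

/-- The choice `t = √(m / 2)` and `N = ⌈(gaussianTail t)⁻¹⌉` normalises the expected number of
inequalities violated at a point of the unit sphere to lie between `1` and `2`. -/
theorem exists_mem_polytopesWithFacetsLE_symmVol_le {n : ℕ} (hn : 1 ≤ n) {ε m : ℝ} (hε : 0 < ε)
    (hε1 : ε ≤ 1) (hm : 16 ≤ m / n) (hmε : 8 * Real.log ε⁻¹ / ε ≤ m / n) :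
    ∃ P ∈ polytopesWithFacetsLE n (Real.exp m),
      symmVol (unitBall n) P ≤ ENNReal.ofReal (6 * ε) * volume (unitBall n) := by
  have hn' : (1 : ℝ) ≤ n := by exact_mod_cast hn
  have hn0 : (0 : ℝ) < n := by linarith
  have hmn : 16 * n ≤ m := by rwa [le_div_iff₀ hn0] at hm
  set t := √(m / 2) with ht
  have ht2 : t ^ 2 = m / 2 := Real.sq_sqrt (by linarith)
  have ht0 : 0 < t := Real.sqrt_pos.2 (by linarith)
  have hq : 0 < gaussianTail t := gaussianTail_pos ht0.le
  set N := ⌈(gaussianTail t)⁻¹⌉₊ with hN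
  have hNge : (gaussianTail t)⁻¹ ≤ N := Nat.le_ceil _
  have hNlt : (N : ℝ) < (gaussianTail t)⁻¹ + 1 := Nat.ceil_lt_add_one (inv_nonneg.2 hq.le)
  have hN1 : 1 ≤ N * gaussianTail t := by
    rwa [inv_le_iff_one_le_mul₀ hq] at hNge
  have hN2 : N * gaussianTail t ≤ 2 := by
    calc N * gaussianTail t ≤ ((gaussianTail t)⁻¹ + 1) * gaussianTail t := by gcongr
      _ = 1 + gaussianTail t := by field_simp
      _ ≤ 2 := by linarith [gaussianTail_le_one t]
  obtain ⟨v, hv⟩ := exists_symmVol_slicedCube_le (N := N) (H := m / n / 2) hn hε hε1 ht0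
    (by rw [ht2]; field_simp) (by linarith)
    (by rw [div_le_iff₀ hε] at hmε; linarith) hN1 hN2
  refine ⟨slicedCube t v, slicedCube_mem_polytopesWithFacetsLE ht0 v ?_, hv⟩
  set X := Real.exp (m / 2) with hX
  have hX2 : Real.exp m = X * X := by rw [hX, ← Real.exp_add]; congr 1; ring
  have hX1 : 1 + 8 * n + 32 * n ^ 2 ≤ X := by
    have := Real.quadratic_le_exp_of_nonneg (show 0 ≤ m / 2 by linarith)
    nlinarith
  have hinv : (gaussianTail t)⁻¹ ≤ 9 * X := by
    have h1 := inv_anti₀ (by positivity) (exp_le_gaussianTail ht0.le)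
    rw [mul_inv, inv_inv, ← Real.exp_neg] at h1
    have h2 : √(2 * Real.pi) ≤ 3 := Real.sqrt_le_iff.2 ⟨by norm_num, by linarith [Real.pi_lt_four]⟩
    have h3 : Real.exp (-(-(t + 1) ^ 2 / 2)) ≤ 3 * X := by
      calc Real.exp (-(-(t + 1) ^ 2 / 2)) ≤ Real.exp (1 + m / 2) :=
            Real.exp_le_exp.2 (by nlinarith [sq_nonneg (t - 1)])
        _ = Real.exp 1 * X := Real.exp_add _ _
        _ ≤ 3 * X := by gcongr; exact Real.exp_one_lt_three.le
    calc _ ≤ _ := h1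
      _ ≤ 3 * (3 * X) := by gcongr
      _ = 9 * X := by ring
  rw [hX2]
  nlinarith

theorem corollary2p6 (f g : ℕ → ℝ)
    (hg : Tendsto (fun n : ℕ => g n / (n : ℝ)) atTop atTop)
    (hf : ∀ᶠ n : ℕ in atTop, f n = Real.exp (g n)) :
    Tendsto (fun n : ℕ =>
        (⨅ P ∈ polytopesWithFacetsLE n (f n), symmVol (unitBall n) P) / volume (unitBall n))
      atTop (𝓝 0) ∧
    ∀ P : (n : ℕ) → Set (EuclideanSpace ℝ (Fin n)),
      (∀ᶠ n : ℕ in atTop, IsBestApprox n (f n) (P n)) →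
        Tendsto (fun n : ℕ => symmVol (unitBall n) (P n) / volume (unitBall n))
          atTop (𝓝 0) := by
  have hinf : Tendsto (fun n : ℕ =>
        (⨅ P ∈ polytopesWithFacetsLE n (f n), symmVol (unitBall n) P) / volume (unitBall n))
      atTop (𝓝 0) := by
    rw [ENNReal.tendsto_nhds_zero]
    intro δ hδ
    obtain ⟨ε, hε, hε1, hεδ⟩ : ∃ ε : ℝ, 0 < ε ∧ ε ≤ 1 ∧ ENNReal.ofReal (6 * ε) ≤ δ := by
      have hmin : 0 < min δ 1 := lt_min hδ one_pos
      have hmin' : min δ 1 ≠ ⊤ := ne_top_of_le_ne_top ENNReal.one_ne_top (min_le_right _ _)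
      refine ⟨(min δ 1).toReal / 6, div_pos (ENNReal.toReal_pos hmin.ne' hmin') (by norm_num),
        ?_, ?_⟩
      · have := ENNReal.toReal_mono ENNReal.one_ne_top (min_le_right δ 1)
        rw [ENNReal.toReal_one] at this
        linarith
      · rw [mul_div_cancel₀ _ (by norm_num), ENNReal.ofReal_toReal hmin']
        exact min_le_left _ _
    filter_upwards [hf, eventually_ge_atTop 1, hg.eventually_ge_atTop 16,
      hg.eventually_ge_atTop (8 * Real.log ε⁻¹ / ε)] with n hfn hn h16 hmε
    obtain ⟨P, hP, hPvol⟩ := exists_mem_polytopesWithFacetsLE_symmVol_le hn hε hε1 h16 hmε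
    rw [← hfn] at hP
    refine ENNReal.div_le_of_le_mul ((iInf₂_le P hP).trans (hPvol.trans ?_))
    gcongr
  refine ⟨hinf, fun P hP => hinf.congr' ?_⟩
  filter_upwards [hP] with n hn
  congr 1
  exact le_antisymm (iInf₂_le _ hn.1) (le_iInf₂ hn.2)
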